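/- All graphs are finite, simple and undirected. For a graph $G$ of order $n$, let $\delta=\delta(G)$ be its minimum degree and let $\rho(G)$ be its spectral radius, i.e. the largest eigenvalue of its adjacency matrix. Let $\kappa=\kappa(G)$ be its vertex-connectivity: the minimum number of vertices whose removal disconnects $G$ if $G$ is not complete, and $n-1$ if $G=K_n$. Let $G_1\cup G_2$ denote the disjoint union of graphs, and let $G_1\vee G_2$ be obtained from it by joining every vertex of $G_1$ to every vertex of $G_2$. Graphs are identified up to isomorphism. **Theorem 3.4.** Let $G$ be a connected graph of order $n$, minimum degree $\delta\ge 2$ and vertex-connectivity $\kappa$. If $n\ge \delta^2-2\delta+7$ and $\rho(G)\ge n-3$, then $\kappa=\delta$, unless $G=K_{\delta-1}\vee(K_2\cup K_{n-\delta-1})$ (for this graph $\kappa\neq\delta$). Moreover, the bound on the order is best possible when $\delta\ge 3$: for every integer $\delta\ge 3$, with $n=\delta^2-2\delta+6$, there is a connected graph $G$ of order $n$ and minimum degree $\delta$ such that $\rho(G)>n-3$ and $\kappa(G)\ne\delta$, but $G\neq K_{\delta-1}\vee(K_2\cup K_{n-\delta-1})$. -/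

import Mathlib

open scoped SimpleGraph

/-- `S` is a vertex-cut of `G`: deleting the vertices of `S` leaves a disconnected graph, that is,
two remaining vertices that are not joined by a path. -/
def IsVertexCut {V : Type*} (G : SimpleGraph V) (S : Finset V) : Prop :=
  ¬ (G.induce {v : V | v ∉ S}).Preconnected

open Classical in
/-- The vertex-connectivity `κ(G)` of a finite connected graph: `n - 1` for the complete graph of
order `n`, and otherwise the minimum cardinality of a vertex-cut. (A graph that is not complete has
a vertex-cut: all vertices but two non-adjacent ones.) -/
noncomputable def vertexConnectivity {V : Type*} [Fintype V] (G : SimpleGraph V) : ℕ :=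
  if G = ⊤ then Fintype.card V - 1
  else sInf {k : ℕ | ∃ S : Finset V, IsVertexCut G S ∧ S.card = k}

/-- The spectral radius `ρ(G)`: the largest eigenvalue of the real adjacency matrix of `G`.
(The spectrum of the matrix is finite, and nonempty as soon as `G` has a vertex.) -/
noncomputable def graphSpectralRadius {V : Type*} [Fintype V] [DecidableEq V]
    (G : SimpleGraph V) [DecidableRel G.Adj] : ℝ :=
  sSup (spectrum ℝ (G.adjMatrix ℝ))

/-- The join `G ∨ H`: the disjoint union of `G` and `H` together with all edges between them. -/
def graphJoin {V W : Type*} (G : SimpleGraph V) (H : SimpleGraph W) : SimpleGraph (V ⊕ W) :=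
  (G ⊕g H) ⊔ completeBipartiteGraph V W

/-- The graph `K_a ∨ (K_b ∪ K_c)`. -/
def joinOfCompletes (a b c : ℕ) : SimpleGraph (Fin a ⊕ (Fin b ⊕ Fin c)) :=
  graphJoin (⊤ : SimpleGraph (Fin a)) ((⊤ : SimpleGraph (Fin b)) ⊕g (⊤ : SimpleGraph (Fin c)))

/-! ### Spectral radius: upper bounds from positive test vectors, lower bounds from Rayleigh
quotients. -/

section Spectral

variable {V : Type*} [Fintype V] [DecidableEq V]

/-! Put `d = δ - 1` and `L = n - 2`; the condition on the order reads `n ≥ d ^ 2 + 6`. Since `κ ≤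
δ`, failure of `κ = δ` gives a cut with fewer than `δ` vertices. Padded to a set `S` of exactly `d`
vertices, it separates `X` from `Y` with `2 ≤ |X| ≤ |Y|`
(`exists_separation_of_vertexConnectivity_lt`). If `|X| = 2` and all edges outside `X` are present,
the minimum degree forces all edges inside `X` and from `X` to `S`, which is the exceptional graph.

In every other case `ρ < n - 3`, because some positive `w` satisfies `A w < (n - 3) w` entrywise. It
is `x` on `X` and about `1` elsewhere, with corrections on `S` and at a non-edge `u v` chosen so
that every row outside `X` reduces to one inequality: the total weight `T` outside `X` is below `L`.
This bounds `x` from above, the rows in `X` bound it from below, and the order condition leaves room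
between the bounds.

For `|X| = 2` with one missing edge the room exists exactly when `d ^ 2 * (L + 1) < L * (L - 2) - 2
* d` (the right side being positive). This holds for `L ≥ d ^ 2 + 4` and is reversed at `L = d ^ 2 +
3` when `d ≥ 2`. In the reversed case the same kind of vector is a Rayleigh test vector showing `ρ >
n - 3`, whence sharpness. -/

theorem spectrum_adjMatrix_nonempty [Nonempty V] (G : SimpleGraph V) [DecidableRel G.Adj] :
    (spectrum ℝ (G.adjMatrix ℝ)).Nonempty := by
  have hA : (G.adjMatrix ℝ).IsHermitian := G.isSymm_adjMatrix
  rw [hA.spectrum_real_eq_range_eigenvalues]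
  exact Set.range_nonempty _

theorem spectrum_adjMatrix_finite (G : SimpleGraph V) [DecidableRel G.Adj] :
    (spectrum ℝ (G.adjMatrix ℝ)).Finite := by
  have hA : (G.adjMatrix ℝ).IsHermitian := G.isSymm_adjMatrix
  rw [hA.spectrum_real_eq_range_eigenvalues]
  exact Set.finite_range _

/-- A positive vector `w` with `A w < r w` entrywise bounds every eigenvalue of a nonnegative
matrix `A` strictly by `r`. -/
theorem eigenvalue_lt_of_mulVec_lt (A : Matrix V V ℝ) (hA : ∀ i j, 0 ≤ A i j) (w : V → ℝ)
    (hw : ∀ i, 0 < w i) (r : ℝ) (h : ∀ i, ∑ j, A i j * w j < r * w i) {μ : ℝ}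
    (hμ : μ ∈ spectrum ℝ A) : μ < r := by
  rw [← Matrix.spectrum_toLin', ← Module.End.hasEigenvalue_iff_mem_spectrum] at hμ
  obtain ⟨v, hv⟩ := hμ.exists_hasEigenvector
  have hv0 : v ≠ 0 := hv.2
  have hv1 : ∀ i, ∑ j, A i j * v j = μ * v i := fun i => by
    have := congrFun hv.apply_eq_smul i
    simpa [Matrix.toLin'_apply, Matrix.mulVec, dotProduct] using this
  obtain ⟨k, hk⟩ := Function.ne_iff.1 hv0
  have : Nonempty V := ⟨k⟩
  -- At an index maximizing `|v i| / w i`, the eigenvector is dominated by `t * w` with equality at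
  -- `i`; row `i` then compares `μ` with `r`.
  obtain ⟨i, hi⟩ := Finite.exists_max (fun i => |v i| / w i)
  set t := |v i| / w i with ht
  have htpos : 0 < t := lt_of_lt_of_le (div_pos (abs_pos.2 hk) (hw k)) (hi k)
  have hle : ∀ j, |v j| ≤ t * w j := fun j => (div_le_iff₀ (hw j)).1 (hi j)
  have hvi : |v i| = t * w i := by rw [ht, div_mul_cancel₀ _ (hw i).ne']
  have h1 : μ * |v i| ≤ ∑ j, A i j * |v j| := by
    calc μ * |v i| ≤ |μ * v i| := by
          rw [abs_mul]; exact mul_le_mul_of_nonneg_right (le_abs_self _) (abs_nonneg _)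
      _ = |∑ j, A i j * v j| := by rw [hv1]
      _ ≤ ∑ j, |A i j * v j| := Finset.abs_sum_le_sum_abs _ _
      _ = ∑ j, A i j * |v j| := by simp_rw [abs_mul, abs_of_nonneg (hA _ _)]
  have h2 : ∑ j, A i j * |v j| ≤ t * ∑ j, A i j * w j := by
    rw [Finset.mul_sum]
    refine Finset.sum_le_sum fun j _ => ?_
    calc A i j * |v j| ≤ A i j * (t * w j) := mul_le_mul_of_nonneg_left (hle j) (hA i j)
      _ = _ := by ring
  have h3 : μ * |v i| < r * |v i| := by
    calc μ * |v i| ≤ t * ∑ j, A i j * w j := h1.trans h2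
      _ < t * (r * w i) := mul_lt_mul_of_pos_left (h i) htpos
      _ = r * |v i| := by rw [hvi]; ring
  exact lt_of_mul_lt_mul_right h3 (abs_nonneg _)

theorem graphSpectralRadius_lt_of_row_sum_lt [Nonempty V] (G : SimpleGraph V)
    [DecidableRel G.Adj] (w : V → ℝ) (hw : ∀ i, 0 < w i) (r : ℝ)
    (h : ∀ i, ∑ j, (if G.Adj i j then w j else 0) < r * w i) : graphSpectralRadius G < r := by
  refine eigenvalue_lt_of_mulVec_lt (G.adjMatrix ℝ) (fun i j => ?_) w hw r (fun i => ?_)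
    ((spectrum_adjMatrix_nonempty G).csSup_mem (spectrum_adjMatrix_finite G))
  · rw [SimpleGraph.adjMatrix_apply]; split_ifs <;> norm_num
  · simpa [SimpleGraph.adjMatrix_apply, ite_mul] using h i

/-- Rayleigh's principle: the quadratic form of the adjacency matrix bounds the spectral radius
from below. -/
theorem lt_graphSpectralRadius_of_dotProduct (G : SimpleGraph V) [DecidableRel G.Adj]
    (w : V → ℝ) (r : ℝ)
    (h : r * ∑ i, w i * w i < ∑ i, w i * ∑ j, (if G.Adj i j then w j else 0)) :
    r < graphSpectralRadius G := by
  by_contra! hr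
  have hA : (G.adjMatrix ℝ).IsHermitian := G.isSymm_adjMatrix
  have hB : (algebraMap ℝ (Matrix V V ℝ) r - G.adjMatrix ℝ).IsHermitian := by
    refine Matrix.IsHermitian.sub ?_ hA
    rw [Matrix.IsHermitian, Matrix.algebraMap_eq_diagonal]
    simp
  have hpos : (algebraMap ℝ (Matrix V V ℝ) r - G.adjMatrix ℝ).PosSemidef := by
    rw [hB.posSemidef_iff_eigenvalues_nonneg]
    intro i
    have hi : hB.eigenvalues i ∈ spectrum ℝ (algebraMap ℝ (Matrix V V ℝ) r - G.adjMatrix ℝ) := by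
      rw [hB.spectrum_real_eq_range_eigenvalues]; exact ⟨i, rfl⟩
    rw [← spectrum.singleton_sub_eq] at hi
    obtain ⟨_, rfl, μ, hμ, hμi⟩ := Set.mem_sub.1 hi
    have : μ ≤ graphSpectralRadius G := le_csSup (spectrum_adjMatrix_finite G).bddAbove hμ
    simp only [Pi.zero_apply]
    linarith
  have := hpos.dotProduct_mulVec_nonneg w
  rw [Matrix.sub_mulVec, dotProduct_sub, Algebra.algebraMap_eq_smul_one, Matrix.smul_mulVec,
    Matrix.one_mulVec, dotProduct_smul] at this
  simp only [dotProduct, Matrix.mulVec, SimpleGraph.adjMatrix_apply,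
    ite_mul, one_mul, zero_mul, Pi.star_apply, star_trivial, smul_eq_mul] at this
  linarith

end Spectral

/-! ### The test vector of a separation. -/

section Weights

variable {V : Type*} [Fintype V] [DecidableEq V]

/-- The weight `x` on `X`, and outside `X` the weight `1`, raised by `α` on `S` and lowered by `γ`
at `u` and `v`. -/
def separationWeight (X S : Finset V) (u v : V) (x α γ : ℝ) (i : V) : ℝ :=
  if i ∈ X then x
  else 1 + (if i ∈ S then α else 0) - (if i = u then γ else 0) - (if i = v then γ else 0)

theorem sum_ite_mem_const (X : Finset V) (c : ℝ) :
    ∑ j, (if j ∈ X then c else 0) = X.card * c := by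
  rw [Finset.sum_ite_mem]; simp

/-- This is the total `T` against which every row outside `X` is compared. -/
theorem sum_separationWeight_compl {X S : Finset V} (hXS : Disjoint X S) {u v : V}
    (hu : u ∉ X) (hv : v ∉ X) (x α γ : ℝ) :
    ∑ j, (if j ∈ X then 0 else separationWeight X S u v x α γ j)
      = (Fintype.card V - X.card) + S.card * α - 2 * γ := by
  have : ∀ j, (if j ∈ X then 0 else separationWeight X S u v x α γ j)
      = 1 - (if j ∈ X then 1 else 0) + (if j ∈ S then α else 0) - (if j = u then γ else 0)
        - (if j = v then γ else 0) := by
    intro j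
    unfold separationWeight
    by_cases hj : j ∈ X
    · have h1 : j ∉ S := Finset.disjoint_left.1 hXS hj
      have h2 : j ≠ u := fun h => hu (h ▸ hj)
      have h3 : j ≠ v := fun h => hv (h ▸ hj)
      simp [hj, h1, h2, h3]
    · simp [hj]
  simp_rw [this, Finset.sum_sub_distrib, Finset.sum_add_distrib, Finset.sum_sub_distrib,
    sum_ite_mem_const]
  simp
  ring

/-- A graph in which `X` is separated from the complement of `X ∪ S`, and in which `u v` is not an
edge unless `c = 0`, has spectral radius below `n - 3` under numerical conditions. -/
theorem graphSpectralRadius_lt_of_separation (G : SimpleGraph V) [DecidableRel G.Adj]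
    {X S : Finset V} (hXS : Disjoint X S) (hsep : ∀ i ∈ X, ∀ j, G.Adj i j → j ∈ X ∨ j ∈ S)
    {u v : V} (hu : u ∉ X) (hv : v ∉ X) (huv : u ≠ v) {x c L : ℝ} (hx : 0 < x) (hc : 0 ≤ c)
    (hL : 0 < L) (hn : L = Fintype.card V - 2) (hcL : c * (L + 1) ≤ L)
    (hadj : G.Adj u v → c = 0)
    (hT : (Fintype.card V - X.card) + S.card * (X.card * x / L) - 2 * (c / L) < L)
    (hXrow : X.card * x + S.card * (1 + X.card * x / L) < L * x) :
    graphSpectralRadius G < Fintype.card V - 3 := by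
  have : Nonempty V := ⟨u⟩
  -- A row `i` outside `X` sums to at most `T - w i`, plus `|X| * x` if `i ∈ S`, minus `c` if `i` is
  -- `u` or `v`. These values of `α` and `γ` make `L * w i` equal to `L` with the same corrections,
  -- so only `T < L` is needed.
  set α := X.card * x / L with hα
  set γ := c / L with hγ
  have hα0 : 0 ≤ α := by positivity
  have hγ0 : 0 ≤ γ := by positivity
  have hLα : L * α = X.card * x := by rw [hα]; field_simp
  have hLγ : L * γ = c := by rw [hγ]; field_simp
  -- The least weight outside `X` is at least `1 - γ`, so a missing edge `u v` costs the rows of `u`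
  -- and `v` at least `c`.
  have hcγ : c ≤ 1 - γ := by
    have : c * L + L * γ ≤ L := by rw [hLγ]; linarith
    nlinarith
  have hγ1 : γ < 1 := by
    have : c < L := by nlinarith
    rw [hγ, div_lt_one hL]; exact this
  set w := separationWeight X S u v x α γ with hw
  have hwX : ∀ j ∈ X, w j = x := fun j hj => by simp [hw, separationWeight, hj]
  have hwH : ∀ j, j ∉ X → w j = 1 + (if j ∈ S then α else 0) - (if j = u then γ else 0)
      - (if j = v then γ else 0) := fun j hj => by simp [hw, separationWeight, hj]
  have hwlow : ∀ j, j ∉ X → 1 - γ ≤ w j := fun j hj => by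
    rw [hwH j hj]
    by_cases h1 : j = u
    · have : j ≠ v := fun h => huv (h1.symm.trans h)
      split_ifs <;> linarith
    · split_ifs <;> linarith
  have hwpos : ∀ j, 0 < w j := fun j => by
    by_cases hj : j ∈ X
    · rw [hwX j hj]; exact hx
    · have := hwlow j hj; linarith
  refine graphSpectralRadius_lt_of_row_sum_lt G w hwpos _ fun i => ?_
  have hr : (Fintype.card V : ℝ) - 3 = L - 1 := by rw [hn]; ring
  rw [hr]
  by_cases hi : i ∈ X
  · have hpt : ∀ j, (if G.Adj i j then w j else 0) ≤
        (if j ∈ X then x else 0) - (if j = i then x else 0) + (if j ∈ S then 1 + α else 0) := by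
      intro j
      by_cases hij : G.Adj i j
      · have hne : j ≠ i := hij.ne'
        rcases hsep i hi j hij with h | h
        · have : j ∉ S := Finset.disjoint_left.1 hXS h
          simp [hij, hne, h, this, hwX j h]
        · have h' : j ∉ X := Finset.disjoint_right.1 hXS h
          rw [hwH j h']
          simp only [hij, hne, h, h', if_true, if_false]
          split_ifs <;> linarith
      · rw [if_neg hij]
        by_cases hji : j = i
        · subst hji
          simp [hi, Finset.disjoint_left.1 hXS hi]
        · simp only [hji, if_false]
          split_ifs <;> linarith
    refine (Finset.sum_le_sum fun j _ => hpt j).trans_lt ?_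
    simp_rw [Finset.sum_add_distrib, Finset.sum_sub_distrib, sum_ite_mem_const]
    rw [hwX i hi]
    simp only [Finset.sum_ite_eq', Finset.mem_univ, if_true]
    linarith
  · have hpt : ∀ j, (if G.Adj i j then w j else 0) ≤
        (if j ∈ X then 0 else w j) + (if j ∈ X then (if i ∈ S then x else 0) else 0)
          - (if j = i then w i else 0) - (if j = v then (if i = u then c else 0) else 0)
          - (if j = u then (if i = v then c else 0) else 0) := by
      intro j
      by_cases hij : G.Adj i j
      · have hne : j ≠ i := hij.ne'
        have e1 : (if j = v then (if i = u then c else 0) else 0) = 0 := by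
          split_ifs with h1 h2
          · subst h1 h2; exact hadj hij
          · rfl
          · rfl
        have e2 : (if j = u then (if i = v then c else 0) else 0) = 0 := by
          split_ifs with h1 h2
          · subst h1 h2; exact hadj hij.symm
          · rfl
          · rfl
        rw [e1, e2]
        by_cases hj : j ∈ X
        · have : i ∈ S := (hsep j hj i hij.symm).resolve_left hi
          simp [hij, hne, hj, this, hwX j hj]
        · simp [hij, hne, hj]
      · rw [if_neg hij]
        by_cases hji : j = i
        · subst hji
          have : ¬ (j = u ∧ j = v) := fun h => huv (h.1.symm.trans h.2)
          by_cases h1 : j = u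
          · have h2 : j ≠ v := fun h => this ⟨h1, h⟩
            simp [h1, huv] at *
            simp [hu]
          · simp [hi, h1]
        · by_cases hj : j ∈ X
          · have h1 : j ≠ u := fun h => hu (h ▸ hj)
            have h2 : j ≠ v := fun h => hv (h ▸ hj)
            simp only [hj, hji, h1, h2, if_true, if_false]
            split_ifs <;> linarith
          · have := hwlow j hj
            have hle : 0 ≤ w j - c := by linarith
            have := hwpos j
            simp only [hj, hji, if_false]
            by_cases h1 : j = u
            · have h2 : j ≠ v := fun h => huv (h1.symm.trans h)
              simp only [h1, huv, if_true, if_false] at *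
              split_ifs <;> linarith
            · simp only [h1, if_false]
              split_ifs <;> linarith
    refine (Finset.sum_le_sum fun j _ => hpt j).trans_lt ?_
    simp_rw [Finset.sum_sub_distrib, Finset.sum_add_distrib, sum_ite_mem_const]
    rw [hw, sum_separationWeight_compl hXS hu hv, ← hw]
    simp only [Finset.sum_ite_eq', Finset.mem_univ, if_true]
    have hLw : L * w i = L + (if i ∈ S then L * α else 0) - (if i = u then L * γ else 0)
        - (if i = v then L * γ else 0) := by
      rw [hwH i hi]; split_ifs <;> ring
    rw [hLα, hLγ] at hLw
    have e : (X.card : ℝ) * (if i ∈ S then x else 0) = if i ∈ S then X.card * x else 0 := by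
      split_ifs <;> simp
    rw [e]
    linarith

/-- The join of `S` with the disjoint union of complete graphs on `X`, of order two, and on the
remaining vertices, less an edge `u v` outside `X ∪ S`. -/
theorem lt_graphSpectralRadius_of_adj_iff (G : SimpleGraph V) [DecidableRel G.Adj]
    {X S : Finset V} (hXS : Disjoint X S) {u v : V} (hu : u ∉ X) (hv : v ∉ X) (huS : u ∉ S)
    (hvS : v ∉ S) (huv : u ≠ v)
    (hadj : ∀ i j, G.Adj i j ↔ i ≠ j ∧ (i ∈ X → j ∈ X ∨ j ∈ S) ∧ (j ∈ X → i ∈ X ∨ i ∈ S) ∧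
      ¬ (i = u ∧ j = v) ∧ ¬ (i = v ∧ j = u))
    (hX : X.card = 2) {m : ℝ} (hm : m = Fintype.card V - 2) (hm2 : 2 < m)
    (hpos : 0 < m * (m - 2) - 2 * S.card) (hS : 0 < S.card)
    (hlt : m * (m - 2) - 2 * S.card < S.card ^ 2 * (m + 1)) :
    (Fintype.card V : ℝ) - 3 < graphSpectralRadius G := by
  have hS' : (0 : ℝ) < S.card := by exact_mod_cast hS
  set d : ℝ := (S.card : ℝ) with hd
  -- This `x` solves the row equation on `X`, and `c` below solves `c = 1 - c / m`, so that `u` and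
  -- `v` have weight exactly `c`.
  set x := d * m / (m * (m - 2) - 2 * d) with hx
  set c := m / (m + 1) with hc
  set α := 2 * x / m with hα
  set γ := c / m with hγ
  have hm0 : 0 < m := by linarith
  have hx0 : 0 < x := by positivity
  have hLα : m * α = 2 * x := by rw [hα]; field_simp
  have hγ' : γ = 1 / (m + 1) := by rw [hγ, hc]; field_simp
  have hcγ : c = 1 - γ := by rw [hγ', hc]; field_simp; ring
  have hLγ : m * γ = c := by rw [hγ]; field_simp
  -- Equivalent to the last hypothesis; it says that the weight outside `X` exceeds `m`.
  have hxc : c < d * x := by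
    rw [hc, hx, ← mul_div_assoc, div_lt_div_iff₀ (by linarith) hpos]
    nlinarith
  have hxrow : m * x = 2 * x + d * (1 + α) := by
    have h1 : x * (m * (m - 2) - 2 * d) = d * m := by
      rw [hx, div_mul_cancel₀ _ hpos.ne']
    have h2 : m * (m * x) = m * (2 * x + d * (1 + α)) := by
      have : m * (2 * x + d * (1 + α)) = 2 * x * m + d * m + d * (m * α) := by ring
      rw [this, hLα]; linarith
    exact mul_left_cancel₀ hm0.ne' h2
  have hγ1 : γ < 1 := by rw [hγ', div_lt_one (by linarith)]; linarith
  have hγ0 : 0 < γ := by rw [hγ']; positivity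
  have hα0 : 0 < α := by positivity
  set w := separationWeight X S u v x α γ with hw
  have hwX : ∀ j ∈ X, w j = x := fun j hj => by simp [hw, separationWeight, hj]
  have hwH : ∀ j, j ∉ X → w j = 1 + (if j ∈ S then α else 0) - (if j = u then γ else 0)
      - (if j = v then γ else 0) := fun j hj => by simp [hw, separationWeight, hj]
  have hwu : w u = c := by rw [hwH u hu]; simp [huS, huv, hcγ]
  have hwv : w v = c := by rw [hwH v hv]; simp [hvS, huv.symm, hcγ]
  have hwpos : ∀ j, 0 < w j := fun j => by
    by_cases hj : j ∈ X
    · rw [hwX j hj]; exact hx0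
    · rw [hwH j hj]
      by_cases h1 : j = u
      · have : j ≠ v := fun h => huv (h1.symm.trans h)
        split_ifs <;> linarith
      · split_ifs <;> linarith
  -- Rows in `X` are eigenvector equations for `m - 1`; all other rows have the same positive
  -- surplus `T - m`.
  have hrow : ∀ i, ∑ j, (if G.Adj i j then w j else 0) = (m - 1) * w i +
      (if i ∈ X then 0 else 2 * (d * x - c) / m) := by
    intro i
    by_cases hi : i ∈ X
    · have hpt : ∀ j, (if G.Adj i j then w j else 0) =
          (if j ∈ X then x else 0) - (if j = i then x else 0) + (if j ∈ S then 1 + α else 0) := by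
        intro j
        have hiu : i ≠ u := fun h => hu (h ▸ hi)
        have hiv : i ≠ v := fun h => hv (h ▸ hi)
        by_cases hji : j = i
        · subst hji; simp [hi, Finset.disjoint_left.1 hXS hi]
        · by_cases hj : j ∈ X
          · have : j ∉ S := Finset.disjoint_left.1 hXS hj
            simp [hadj, hi, hj, hji, Ne.symm hji, hiu, hiv, this, hwX j hj]
          · by_cases hjS : j ∈ S
            · have h1 : j ≠ u := fun h => huS (h ▸ hjS)
              have h2 : j ≠ v := fun h => hvS (h ▸ hjS)
              simp [hadj, hi, hj, hji, Ne.symm hji, hiu, hiv, hjS, hwH j hj, h1, h2]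
            · simp [hadj, hi, hj, hji, hjS]
      simp_rw [hpt, Finset.sum_add_distrib, Finset.sum_sub_distrib, sum_ite_mem_const]
      rw [hwX i hi]
      simp only [Finset.sum_ite_eq', Finset.mem_univ, if_true, hX, hi]
      push_cast
      linarith
    · have hpt : ∀ j, (if G.Adj i j then w j else 0) =
          (if j ∈ X then 0 else w j) + (if j ∈ X then (if i ∈ S then x else 0) else 0)
            - (if j = i then w i else 0) - (if j = v then (if i = u then c else 0) else 0)
            - (if j = u then (if i = v then c else 0) else 0) := by
        intro j
        by_cases hji : j = i
        · subst hji
          by_cases h1 : j = u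
          · subst h1; simp [hi, huv]
          · simp [hi, h1]
        · by_cases hj : j ∈ X
          · have h1 : j ≠ u := fun h => hu (h ▸ hj)
            have h2 : j ≠ v := fun h => hv (h ▸ hj)
            simp [hadj, hi, hj, hji, Ne.symm hji, h1, h2, hwX j hj]
          · by_cases h1 : j = u
            · subst h1
              by_cases h2 : i = v
              · subst h2; simp [hadj, hi, hj, hji, hwu]
              · simp [hadj, hi, hj, hji, Ne.symm hji, huv, h2]
            · by_cases h2 : j = v
              · subst h2
                by_cases h3 : i = u
                · subst h3; simp [hadj, hi, hj, hji, hwv]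
                · simp [hadj, hi, hj, hji, Ne.symm hji, h1, h3]
              · simp [hadj, hi, hj, hji, Ne.symm hji, h1, h2]
      simp_rw [hpt, Finset.sum_sub_distrib, Finset.sum_add_distrib, sum_ite_mem_const]
      rw [hw, sum_separationWeight_compl hXS hu hv, ← hw]
      simp only [Finset.sum_ite_eq', Finset.mem_univ, if_true, hX, hi, if_false]
      have hLw : m * w i = m + (if i ∈ S then m * α else 0) - (if i = u then m * γ else 0)
          - (if i = v then m * γ else 0) := by
        rw [hwH i hi]; split_ifs <;> ring
      rw [hLα, hLγ] at hLw
      have e : (2 : ℝ) * (if i ∈ S then x else 0) = if i ∈ S then 2 * x else 0 := by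
        split_ifs <;> simp
      have e2 : 2 * (d * x - c) / m = d * α - 2 * γ := by
        rw [hα, hγ]; ring
      push_cast
      rw [e, e2, ← hd]
      linarith
  refine lt_graphSpectralRadius_of_dotProduct G w _ ?_
  have hr : (Fintype.card V : ℝ) - 3 = m - 1 := by rw [hm]; ring
  rw [hr, Finset.mul_sum]
  have hgain : 0 < 2 * (d * x - c) / m := by
    apply div_pos <;> linarith
  refine Finset.sum_lt_sum (fun i _ => ?_) ⟨u, Finset.mem_univ u, ?_⟩
  · rw [hrow]
    have : 0 ≤ (if i ∈ X then 0 else 2 * (d * x - c) / m) := by split_ifs <;> linarith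
    nlinarith [mul_nonneg (hwpos i).le this]
  · rw [hrow, if_neg hu]
    nlinarith [mul_pos (hwpos u) hgain]

end Weights

/-! ### Vertex cuts and separations. -/

section Connectivity

variable {V : Type*}

/-- A walk that avoids `S` and starts in `X` never leaves `X`. -/
theorem isVertexCut_of_separation {G : SimpleGraph V} {X S : Finset V} (hXS : Disjoint X S)
    (hsep : ∀ i ∈ X, ∀ j, G.Adj i j → j ∈ X ∨ j ∈ S) {p q : V} (hp : p ∈ X) (hqX : q ∉ X)
    (hqS : q ∉ S) : IsVertexCut G S := by
  intro h
  obtain ⟨W⟩ := h ⟨p, Finset.disjoint_left.1 hXS hp⟩ ⟨q, hqS⟩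
  have key : ∀ (a b : {v : V | v ∉ S}), (G.induce {v : V | v ∉ S}).Walk a b → a.1 ∈ X →
      b.1 ∈ X := by
    intro a b W
    induction W with
    | nil => exact id
    | @cons _ y _ h _ ih => exact fun ha => ih ((hsep _ ha y.1 h).resolve_right y.2)
  exact hqX (key _ _ W hp)

variable [Fintype V]

theorem vertexConnectivity_le_of_isVertexCut {G : SimpleGraph V} (hG : G ≠ ⊤) {S : Finset V}
    (hS : IsVertexCut G S) : vertexConnectivity G ≤ S.card := by
  rw [vertexConnectivity, if_neg hG]
  exact Nat.sInf_le ⟨S, hS, rfl⟩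

variable [DecidableEq V]

/-- A vertex cut `S` splits off a nonempty set `X` from the nonempty complement of `X ∪ S`. -/
theorem exists_separation_of_isVertexCut {G : SimpleGraph V} {S : Finset V}
    (h : IsVertexCut G S) : ∃ X : Finset V, Disjoint X S ∧
      (∀ i ∈ X, ∀ j, G.Adj i j → j ∈ X ∨ j ∈ S) ∧ X.Nonempty ∧ (X ∪ S)ᶜ.Nonempty := by
  classical
  simp only [IsVertexCut, SimpleGraph.Preconnected, not_forall] at h
  obtain ⟨p, q, hpq⟩ := h
  refine ⟨Finset.univ.filter fun v => ∃ hv : v ∉ S,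
    (G.induce {v : V | v ∉ S}).Reachable p ⟨v, hv⟩, ?_, ?_, ⟨p.1, ?_⟩, ⟨q.1, ?_⟩⟩
  · rw [Finset.disjoint_left]
    intro v hv
    exact (Finset.mem_filter.1 hv).2.1
  · intro i hi j hij
    obtain ⟨hiS, hr⟩ := (Finset.mem_filter.1 hi).2
    by_cases hj : j ∈ S
    · exact Or.inr hj
    · refine Or.inl (Finset.mem_filter.2 ⟨Finset.mem_univ _, hj, hr.trans ?_⟩)
      exact SimpleGraph.Adj.reachable (by simpa using hij)
  · exact Finset.mem_filter.2 ⟨Finset.mem_univ _, p.2, SimpleGraph.Reachable.refl _⟩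
  · have hq : q.1 ∉ S := q.2
    simp only [Finset.mem_compl, Finset.mem_union, Finset.mem_filter, Finset.mem_univ, true_and]
    rintro (⟨_, hr⟩ | hr)
    · exact hpq hr
    · exact hq hr

/-- The neighbourhood of a vertex of minimum degree isolates it; the order hypothesis leaves a
vertex on the other side. -/
theorem vertexConnectivity_le_minDegree (G : SimpleGraph V) [DecidableRel G.Adj]
    (h : G.minDegree + 1 < Fintype.card V) : vertexConnectivity G ≤ G.minDegree := by
  have : Nonempty V := Fintype.card_pos_iff.1 (by omega)
  obtain ⟨v, hv⟩ := G.exists_minimal_degree_vertex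
  have hcard : (insert v (G.neighborFinset v)).card = G.minDegree + 1 := by
    rw [Finset.card_insert_of_notMem (by simp), G.card_neighborFinset_eq_degree, hv]
  obtain ⟨q, hq⟩ : ∃ q, q ∉ insert v (G.neighborFinset v) := by
    by_contra! hall
    have := Finset.card_le_card (fun q _ => hall q : Finset.univ ⊆ insert v (G.neighborFinset v))
    rw [Finset.card_univ] at this
    omega
  simp only [Finset.mem_insert, SimpleGraph.mem_neighborFinset, not_or] at hq
  have hcut : IsVertexCut G (G.neighborFinset v) :=
    isVertexCut_of_separation (X := {v}) (p := v) (q := q) (by simp)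
      (fun i hi j hij => Or.inr (by rw [Finset.mem_singleton] at hi; subst hi; simpa using hij))
      (by simp) (by simpa using hq.1) (by simpa using hq.2)
  have hG : G ≠ ⊤ := by
    rintro rfl
    exact hq.2 (Ne.symm hq.1)
  have := vertexConnectivity_le_of_isVertexCut hG hcut
  rwa [G.card_neighborFinset_eq_degree, ← hv] at this

theorem exists_isVertexCut_of_vertexConnectivity_lt {G : SimpleGraph V} {k : ℕ}
    (hk : k < Fintype.card V) (h : vertexConnectivity G < k) :
    ∃ S : Finset V, IsVertexCut G S ∧ S.card < k := by
  rw [vertexConnectivity] at h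
  split_ifs at h with hG
  · omega
  -- Nonemptiness ensures that the infimum is attained by a cut rather than being the default `sInf
  -- ∅ = 0`.
  · have hne : {k : ℕ | ∃ S : Finset V, IsVertexCut G S ∧ S.card = k}.Nonempty := by
      obtain ⟨a, b, hab, hnadj⟩ : ∃ a b, a ≠ b ∧ ¬ G.Adj a b := by
        by_contra! hall
        exact hG (by ext a b; exact ⟨fun h => h.ne, hall a b⟩)
      refine ⟨_, ({a, b} : Finset V)ᶜ, isVertexCut_of_separation (X := {a}) (p := a) (q := b)
        (by simp) (fun i hi j hij => Or.inr ?_) (by simp) (by simpa using hab.symm) (by simp), rfl⟩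
      rw [Finset.mem_singleton] at hi
      subst hi
      have h1 : j ≠ b := fun hj => hnadj (hj ▸ hij)
      simp [hij.ne', h1]
    obtain ⟨S, hS, hc⟩ := Nat.sInf_mem hne
    exact ⟨S, hS, hc ▸ h⟩

/-- The closed neighbourhood of a vertex of `X` lies in `X ∪ S`. -/
theorem minDegree_lt_card_add_card (G : SimpleGraph V) [DecidableRel G.Adj] {X S : Finset V}
    (hXS : Disjoint X S) (hsep : ∀ i ∈ X, ∀ j, G.Adj i j → j ∈ X ∨ j ∈ S) (hX : X.Nonempty) :
    G.minDegree < X.card + S.card := by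
  obtain ⟨i, hi⟩ := hX
  have hsub : insert i (G.neighborFinset i) ⊆ X ∪ S := by
    intro j hj
    rw [Finset.mem_insert, SimpleGraph.mem_neighborFinset] at hj
    rw [Finset.mem_union]
    rcases hj with rfl | hj
    · exact Or.inl hi
    · exact hsep i hi j hj
  have h1 := Finset.card_le_card hsub
  rw [Finset.card_insert_of_notMem (by simp), G.card_neighborFinset_eq_degree,
    Finset.card_union_of_disjoint hXS] at h1
  have := G.minDegree_le_degree i
  omega

theorem separation_compl {G : SimpleGraph V} {X S : Finset V}
    (hsep : ∀ i ∈ X, ∀ j, G.Adj i j → j ∈ X ∨ j ∈ S) :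
    ∀ i ∈ (X ∪ S)ᶜ, ∀ j, G.Adj i j → j ∈ (X ∪ S)ᶜ ∨ j ∈ S := by
  intro i hi j hij
  simp only [Finset.mem_compl, Finset.mem_union, not_or] at hi ⊢
  by_cases hj : j ∈ S
  · exact Or.inr hj
  · exact Or.inl ⟨fun hX => (hsep j hX i hij.symm).elim hi.1 hi.2, hj⟩

/-- If the connectivity is smaller than the minimum degree `δ`, then some `δ - 1` vertices separate
two sets with at least two vertices each. -/
theorem exists_separation_of_vertexConnectivity_lt (G : SimpleGraph V) [DecidableRel G.Adj]
    (hδ : G.minDegree < Fintype.card V) (h : vertexConnectivity G < G.minDegree) :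
    ∃ X S : Finset V, Disjoint X S ∧ (∀ i ∈ X, ∀ j, G.Adj i j → j ∈ X ∨ j ∈ S) ∧
      S.card + 1 = G.minDegree ∧ 2 ≤ X.card ∧ X.card ≤ (X ∪ S)ᶜ.card := by
  obtain ⟨S₀, hcut, hlt⟩ := exists_isVertexCut_of_vertexConnectivity_lt hδ h
  obtain ⟨X, hXS, hsep, hX, hY⟩ := exists_separation_of_isVertexCut hcut
  have h1 := minDegree_lt_card_add_card G hXS hsep hX
  have h2 := minDegree_lt_card_add_card G
    (by rw [Finset.disjoint_left]; intro a ha; simp at ha; exact ha.2) (separation_compl hsep) hY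
  -- Moving `T` from the far side into the cut makes its size `δ - 1`. Since `|Y| + |S₀| ≥ δ + 1`,
  -- at least two vertices stay on the far side.
  obtain ⟨T, hTY, hT⟩ := Finset.exists_subset_card_eq
    (show G.minDegree - 1 - S₀.card ≤ (X ∪ S₀)ᶜ.card by omega)
  have hT' : ∀ a ∈ T, a ∉ X ∧ a ∉ S₀ := fun a ha => by simpa using hTY ha
  have hST : Disjoint S₀ T := Finset.disjoint_right.2 fun a ha => (hT' a ha).2
  have hXS' : Disjoint X (S₀ ∪ T) := by
    rw [Finset.disjoint_union_right]
    exact ⟨hXS, Finset.disjoint_right.2 fun a ha => (hT' a ha).1⟩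
  have hsep' : ∀ i ∈ X, ∀ j, G.Adj i j → j ∈ X ∨ j ∈ S₀ ∪ T := fun i hi j hij =>
    (hsep i hi j hij).imp id (Finset.mem_union_left T)
  have hcS : (S₀ ∪ T).card + 1 = G.minDegree := by
    rw [Finset.card_union_of_disjoint hST]; omega
  have hYc : (X ∪ (S₀ ∪ T))ᶜ.card + X.card + (S₀ ∪ T).card = Fintype.card V := by
    have := Finset.card_compl_add_card (X ∪ (S₀ ∪ T))
    rw [Finset.card_union_of_disjoint hXS'] at this
    omega
  have hYc₀ : (X ∪ S₀)ᶜ.card + X.card + S₀.card = Fintype.card V := by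
    have := Finset.card_compl_add_card (X ∪ S₀)
    rw [Finset.card_union_of_disjoint hXS] at this
    omega
  rcases le_total X.card (X ∪ (S₀ ∪ T))ᶜ.card with hle | hle
  · exact ⟨X, S₀ ∪ T, hXS', hsep', hcS, by omega, hle⟩
  · have hd : Disjoint (X ∪ (S₀ ∪ T))ᶜ (S₀ ∪ T) := by
      rw [Finset.disjoint_left]; intro a ha hb; simp at ha hb; tauto
    refine ⟨(X ∪ (S₀ ∪ T))ᶜ, S₀ ∪ T, hd, separation_compl hsep', hcS, by omega, hle.trans ?_⟩
    refine Finset.card_le_card fun a ha => ?_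
    have : a ∉ S₀ ∪ T := Finset.disjoint_left.1 hXS' ha
    simp only [Finset.mem_compl, Finset.mem_union] at this ⊢
    tauto

end Connectivity

/-! ### Recognizing the exceptional graph and bounding its connectivity. -/

section JoinOfCompletes

variable {V : Type*} [Fintype V] [DecidableEq V]

theorem nonempty_iso_joinOfCompletes {G : SimpleGraph V} {X S : Finset V} (hXS : Disjoint X S)
    {a b c : ℕ} (hS : S.card = a) (hX : X.card = b) (hn : Fintype.card V = a + b + c)
    (hadj : ∀ i j, G.Adj i j ↔
      i ≠ j ∧ (i ∈ X → j ∈ X ∨ j ∈ S) ∧ (j ∈ X → i ∈ X ∨ i ∈ S)) :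
    Nonempty (G ≃g joinOfCompletes a b c) := by
  have hY : (X ∪ S)ᶜ.card = c := by
    have := Finset.card_compl_add_card (X ∪ S)
    rw [Finset.card_union_of_disjoint hXS] at this
    omega
  let eS := S.equivFinOfCardEq hS
  let eX := X.equivFinOfCardEq hX
  let eY := (X ∪ S)ᶜ.equivFinOfCardEq hY
  let g : Fin a ⊕ (Fin b ⊕ Fin c) → V :=
    Sum.elim (fun i => (eS.symm i).1) (Sum.elim (fun i => (eX.symm i).1) fun i => (eY.symm i).1)
  have m1 : ∀ i, (eS.symm i).1 ∈ S := fun i => (eS.symm i).2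
  have m2 : ∀ i, (eX.symm i).1 ∈ X := fun i => (eX.symm i).2
  have m3 : ∀ i, (eY.symm i).1 ∉ X ∧ (eY.symm i).1 ∉ S := fun i => by
    simpa using (eY.symm i).2
  have m1' : ∀ i, (eS.symm i).1 ∉ X := fun i => Finset.disjoint_right.1 hXS (m1 i)
  have m2' : ∀ i, (eX.symm i).1 ∉ S := fun i => Finset.disjoint_left.1 hXS (m2 i)
  have hinj : Function.Injective g := by
    rintro (i | i | i) (j | j | j) hij
    all_goals simp only [g, Sum.elim_inl, Sum.elim_inr] at hij
    · rw [eS.symm.injective (Subtype.ext hij)]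
    · exact absurd (m2 j) (hij ▸ m1' i)
    · exact absurd (m1 i) (hij ▸ (m3 j).2)
    · exact absurd (m2 i) (hij ▸ m1' j)
    · rw [eX.symm.injective (Subtype.ext hij)]
    · exact absurd (m2 i) (hij ▸ (m3 j).1)
    · exact absurd (m1 j) (hij ▸ (m3 i).2)
    · exact absurd (m2 j) (hij ▸ (m3 i).1)
    · rw [eY.symm.injective (Subtype.ext hij)]
  have hbij : Function.Bijective g := by
    rw [Fintype.bijective_iff_injective_and_card]
    refine ⟨hinj, ?_⟩
    simp only [Fintype.card_sum, Fintype.card_fin]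
    omega
  refine ⟨(RelIso.symm ⟨Equiv.ofBijective g hbij, ?_⟩)⟩
  intro p q
  rw [Equiv.ofBijective_apply, Equiv.ofBijective_apply, hadj, hinj.ne_iff]
  rcases p with i | i | i <;> rcases q with j | j | j <;>
    simp [g, joinOfCompletes, graphJoin, m1, m2, m1', m2', m3]

theorem vertexConnectivity_le_of_iso {G : SimpleGraph V} {a b c : ℕ} (hb : 0 < b) (hc : 0 < c)
    (e : G ≃g joinOfCompletes a b c) : vertexConnectivity G ≤ a := by
  let S : Finset V := Finset.univ.filter fun v => (e v).isLeft
  let X : Finset V := Finset.univ.filter fun v => ∃ i, e v = Sum.inr (Sum.inl i)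
  let p := e.symm (Sum.inr (Sum.inl ⟨0, hb⟩))
  let q := e.symm (Sum.inr (Sum.inr ⟨0, hc⟩))
  have hp : p ∈ X := by simp [X, p]
  have hqX : q ∉ X := by simp [X, q]
  have hqS : q ∉ S := by simp [S, q]
  have hXS : Disjoint X S := by
    rw [Finset.disjoint_left]
    intro v hv hv'
    simp only [X, S, Finset.mem_filter, Finset.mem_univ, true_and] at hv hv'
    obtain ⟨i, hi⟩ := hv
    simp [hi] at hv'
  have hsep : ∀ i ∈ X, ∀ j, G.Adj i j → j ∈ X ∨ j ∈ S := by
    intro v hv u huv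
    simp only [X, S, Finset.mem_filter, Finset.mem_univ, true_and] at hv ⊢
    obtain ⟨i, hi⟩ := hv
    rw [← e.map_adj_iff, hi] at huv
    rcases h : e u with j | j | j
    · simp
    · simp
    · rw [h] at huv
      simp [joinOfCompletes, graphJoin] at huv
  have hG : G ≠ ⊤ := by
    rintro rfl
    have hpq : p ≠ q := fun h => hqX (h ▸ hp)
    exact (hsep p hp q hpq).elim hqX hqS
  refine (vertexConnectivity_le_of_isVertexCut hG
    (isVertexCut_of_separation hXS hsep hp hqX hqS)).trans ?_
  have hsub : S ⊆ Finset.univ.image fun i : Fin a => e.symm (Sum.inl i) := by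
    intro v hv
    simp only [S, Finset.mem_filter, Finset.mem_univ, true_and] at hv
    obtain ⟨i, hi⟩ := Sum.isLeft_iff.1 hv
    exact Finset.mem_image.2 ⟨i, Finset.mem_univ _, by rw [← hi]; simp⟩
  calc S.card ≤ _ := Finset.card_le_card hsub
    _ ≤ _ := Finset.card_image_le
    _ = a := by simp

end JoinOfCompletes

/-- `K_a ∨ (K_b ∪ K_c)` has no three pairwise nonadjacent vertices. -/
theorem adj_of_iso_joinOfCompletes {V : Type*} {G : SimpleGraph V} {a b c : ℕ}
    (e : G ≃g joinOfCompletes a b c) {p q r : V} (hpq : p ≠ q) (hpr : p ≠ r) (hqr : q ≠ r) :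
    G.Adj p q ∨ G.Adj p r ∨ G.Adj q r := by
  rw [← e.map_adj_iff, ← e.map_adj_iff (v := p), ← e.map_adj_iff (v := q)]
  have h1 := e.injective.ne hpq
  have h2 := e.injective.ne hpr
  have h3 := e.injective.ne hqr
  revert h1 h2 h3
  generalize e p = x
  generalize e q = y
  generalize e r = z
  rcases x with i | i | i <;> rcases y with j | j | j <;> rcases z with k | k | k <;>
    simp [joinOfCompletes, graphJoin] <;> tauto

/-! ### The numerical cases, the dichotomy and the extremal graphs. -/

section Extremal

variable {V : Type*} [Fintype V] [DecidableEq V]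

/-- With `|X| = 2` the condition `T < L` becomes `d * x < c`; the largest admissible `c`, namely `L
/ (L + 1)`, gives the widest range for `x`. -/
theorem graphSpectralRadius_lt_of_two_of_not_adj (G : SimpleGraph V) [DecidableRel G.Adj]
    {X S : Finset V} (hXS : Disjoint X S) (hsep : ∀ i ∈ X, ∀ j, G.Adj i j → j ∈ X ∨ j ∈ S)
    (hS : 1 ≤ S.card) (hn : S.card ^ 2 + 6 ≤ Fintype.card V) (hX : X.card = 2)
    {u v : V} (hu : u ∉ X) (hv : v ∉ X) (huv : u ≠ v) (hadj : ¬ G.Adj u v) :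
    graphSpectralRadius G < Fintype.card V - 3 := by
  have hS' : (1 : ℝ) ≤ S.card := by exact_mod_cast hS
  have hn' : (S.card : ℝ) ^ 2 + 6 ≤ Fintype.card V := by exact_mod_cast hn
  obtain ⟨L, hL⟩ : ∃ L : ℝ, L = Fintype.card V - 2 := ⟨_, rfl⟩
  set d : ℝ := (S.card : ℝ) with hd
  have hdL : d ^ 2 + 4 ≤ L := by linarith
  have hL0 : 0 < L := by nlinarith
  have hP : d ^ 2 * (L + 1) < L * (L - 2) - 2 * d := by
    nlinarith [mul_nonneg (by linarith : 0 ≤ L + 1) (by linarith : 0 ≤ L - d ^ 2 - 4),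
      sq_nonneg (d - 1)]
  have hP0 : 0 < L * (L - 2) - 2 * d := lt_of_le_of_lt (by positivity) hP
  -- The lower bound is the row condition on `X`, the upper bound is `T < L`; `hP` says that they
  -- leave a gap.
  obtain ⟨x, hx1, hx2⟩ : ∃ x, d * L / (L * (L - 2) - 2 * d) < x ∧ x < L / ((L + 1) * d) := by
    refine exists_between ?_
    rw [div_lt_div_iff₀ hP0 (by positivity)]
    nlinarith
  have hx0 : 0 < x := lt_of_le_of_lt (by positivity) hx1
  rw [div_lt_iff₀ hP0] at hx1
  refine graphSpectralRadius_lt_of_separation G hXS hsep hu hv huv (x := x) (c := L / (L + 1))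
    hx0 (by positivity) hL0 hL (by rw [div_mul_cancel₀ _ (by positivity)])
    (fun h => absurd h hadj) ?_ ?_
  · rw [hX, ← hd]
    have h1 : d * x < L / (L + 1) := by
      rw [lt_div_iff₀ (by positivity)] at hx2 ⊢
      linarith
    have h2 : d * x / L < L / (L + 1) / L := div_lt_div_of_pos_right h1 hL0
    have e : d * ((2 : ℕ) * x / L) = 2 * (d * x / L) := by push_cast; ring
    rw [e]
    push_cast
    linarith
  · rw [hX, ← hd]
    push_cast
    have e : d * (1 + 2 * x / L) = (d * L + 2 * d * x) / L := by field_simp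
    rw [e, ← lt_sub_iff_add_lt', div_lt_iff₀ hL0]
    linarith

/-- No missing edge is needed here: already `n - |X| < L`, with slack `|X| - 2`, so `c = 0` suffices
and `u`, `v` are arbitrary. -/
theorem graphSpectralRadius_lt_of_three_le (G : SimpleGraph V) [DecidableRel G.Adj]
    {X S : Finset V} (hXS : Disjoint X S) (hsep : ∀ i ∈ X, ∀ j, G.Adj i j → j ∈ X ∨ j ∈ S)
    (hS : 1 ≤ S.card) (hn : S.card ^ 2 + 6 ≤ Fintype.card V) (hX : 3 ≤ X.card)
    (hXY : X.card ≤ (X ∪ S)ᶜ.card) :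
    graphSpectralRadius G < Fintype.card V - 3 := by
  obtain ⟨u, hu, v, hv, huv⟩ := Finset.one_lt_card.1 (show 1 < (X ∪ S)ᶜ.card by omega)
  simp only [Finset.mem_compl, Finset.mem_union, not_or] at hu hv
  have hcard : 2 * X.card + S.card ≤ Fintype.card V := by
    have := Finset.card_compl_add_card (X ∪ S)
    rw [Finset.card_union_of_disjoint hXS] at this
    omega
  have hS' : (1 : ℝ) ≤ S.card := by exact_mod_cast hS
  have hn' : (S.card : ℝ) ^ 2 + 6 ≤ Fintype.card V := by exact_mod_cast hn
  have hX' : (3 : ℝ) ≤ X.card := by exact_mod_cast hX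
  have hcard' : 2 * (X.card : ℝ) + S.card ≤ Fintype.card V := by exact_mod_cast hcard
  obtain ⟨L, hL⟩ : ∃ L : ℝ, L = Fintype.card V - 2 := ⟨_, rfl⟩
  set d : ℝ := (S.card : ℝ) with hd
  set a : ℝ := (X.card : ℝ) with ha
  have hdL : d ^ 2 + 4 ≤ L := by linarith
  have hL0 : 0 < L := by nlinarith
  have haL : 2 * a ≤ L + 2 - d := by linarith
  have hP3 : 3 * d ^ 2 < L * (L - a) - a * d := by
    nlinarith [mul_nonneg (by linarith : 0 ≤ L + d) (by linarith : 0 ≤ L + 2 - d - 2 * a),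
      mul_nonneg (by linarith : 0 ≤ L - d ^ 2 - 4) (by nlinarith : 0 ≤ L + d ^ 2 + 2),
      sq_nonneg (d - 1), sq_nonneg (d ^ 2)]
  have hP0 : 0 < L * (L - a) - a * d := lt_of_le_of_lt (by positivity) hP3
  -- From `hP3`, since `3 * (a - 2) ≥ a` for `a ≥ 3`.
  have hP : d ^ 2 * a < (a - 2) * (L * (L - a) - a * d) := by
    nlinarith [mul_pos (by linarith : 0 < a - 2) (sub_pos.2 hP3),
      mul_nonneg (sq_nonneg d) (by linarith : 0 ≤ a - 3)]
  obtain ⟨x, hx1, hx2⟩ : ∃ x, d * L / (L * (L - a) - a * d) < x ∧ x < (a - 2) * L / (d * a) := by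
    refine exists_between ?_
    rw [div_lt_div_iff₀ hP0 (by positivity)]
    nlinarith
  have hx0 : 0 < x := lt_of_le_of_lt (by positivity) hx1
  rw [div_lt_iff₀ hP0] at hx1
  refine graphSpectralRadius_lt_of_separation G hXS hsep hu.1 hv.1 huv (x := x) (c := 0)
    hx0 le_rfl hL0 hL (by linarith) (fun _ => rfl) ?_ ?_
  · rw [← hd, ← ha]
    have h1 : d * (a * x / L) < a - 2 := by
      rw [lt_div_iff₀ (by positivity)] at hx2
      rw [← mul_div_assoc, div_lt_iff₀ hL0]
      linarith
    rw [zero_div]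
    linarith
  · rw [← hd, ← ha]
    have e : d * (1 + a * x / L) = (d * L + a * d * x) / L := by field_simp
    rw [e, ← lt_sub_iff_add_lt', div_lt_iff₀ hL0]
    linarith

/-- Here `|X ∪ S| = δ + 1`, so a vertex of `X` reaches degree `δ` only by being adjacent to all the
rest of `X ∪ S`. -/
theorem nonempty_iso_of_two_of_adj (G : SimpleGraph V) [DecidableRel G.Adj]
    {X S : Finset V} (hXS : Disjoint X S) (hsep : ∀ i ∈ X, ∀ j, G.Adj i j → j ∈ X ∨ j ∈ S)
    (hδ : S.card + 1 = G.minDegree) (hX : X.card = 2)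
    (hadj : ∀ u v, u ∉ X → v ∉ X → u ≠ v → G.Adj u v) :
    Nonempty (G ≃g joinOfCompletes (G.minDegree - 1) 2 (Fintype.card V - G.minDegree - 1)) := by
  have hXadj : ∀ i ∈ X, ∀ j, i ≠ j → j ∈ X ∨ j ∈ S → G.Adj i j := by
    intro i hi j hij hj
    have hsub : G.neighborFinset i ⊆ (X ∪ S).erase i := by
      intro k hk
      rw [SimpleGraph.mem_neighborFinset] at hk
      exact Finset.mem_erase.2 ⟨hk.ne', Finset.mem_union.2 (hsep i hi k hk)⟩
    have hc : ((X ∪ S).erase i).card ≤ (G.neighborFinset i).card := by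
      rw [Finset.card_erase_of_mem (Finset.mem_union_left _ hi),
        Finset.card_union_of_disjoint hXS, G.card_neighborFinset_eq_degree]
      have := G.minDegree_le_degree i
      omega
    rw [← SimpleGraph.mem_neighborFinset, Finset.eq_of_subset_of_card_le hsub hc]
    exact Finset.mem_erase.2 ⟨hij.symm, Finset.mem_union.2 hj⟩
  have hcard := Finset.card_le_univ (X ∪ S)
  rw [Finset.card_union_of_disjoint hXS] at hcard
  refine nonempty_iso_joinOfCompletes hXS (by omega) hX (by omega) fun i j => ⟨fun h =>
    ⟨h.ne, fun hi => hsep i hi j h, fun hj => hsep j hj i h.symm⟩, ?_⟩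
  rintro ⟨hij, h1, h2⟩
  by_cases hi : i ∈ X
  · exact hXadj i hi j hij (h1 hi)
  · by_cases hj : j ∈ X
    · exact (hXadj j hj i hij.symm (h2 hj)).symm
    · exact hadj i j hi hj hij

theorem vertexConnectivity_eq_minDegree_or_iso (G : SimpleGraph V) [DecidableRel G.Adj]
    (hδ : 2 ≤ G.minDegree) (hn : (G.minDegree - 1) ^ 2 + 6 ≤ Fintype.card V)
    (hρ : (Fintype.card V : ℝ) - 3 ≤ graphSpectralRadius G) :
    vertexConnectivity G = G.minDegree ∨
    Nonempty (G ≃g joinOfCompletes (G.minDegree - 1) 2 (Fintype.card V - G.minDegree - 1)) := by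
  have hlt : G.minDegree + 1 < Fintype.card V := by
    obtain ⟨e, he⟩ := Nat.exists_eq_add_of_le' (show 1 ≤ G.minDegree by omega)
    rw [he] at hn ⊢
    rw [Nat.add_sub_cancel] at hn
    nlinarith
  rcases (vertexConnectivity_le_minDegree G hlt).eq_or_lt with h | h
  · exact Or.inl h
  right
  obtain ⟨X, S, hXS, hsep, hS, hX, hXY⟩ :=
    exists_separation_of_vertexConnectivity_lt G (by omega) h
  rw [← hS, Nat.add_sub_cancel] at hn
  rcases hX.eq_or_lt with h2 | h3
  · refine nonempty_iso_of_two_of_adj G hXS hsep hS h2.symm fun u v hu hv huv => ?_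
    by_contra hadj
    exact (graphSpectralRadius_lt_of_two_of_not_adj G hXS hsep (by omega) hn h2.symm hu hv huv
      hadj).not_ge hρ
  · exact absurd hρ
      (graphSpectralRadius_lt_of_three_le G hXS hsep (by omega) hn h3 hXY).not_ge

/-- The join of `S` with the disjoint union of complete graphs on `X` and on the remaining vertices,
less the edge `u v`. -/
def separatedGraph (X S : Finset V) (u v : V) : SimpleGraph V where
  Adj i j := i ≠ j ∧ (i ∈ X → j ∈ X ∨ j ∈ S) ∧ (j ∈ X → i ∈ X ∨ i ∈ S) ∧
    ¬ (i = u ∧ j = v) ∧ ¬ (i = v ∧ j = u)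
  symm := ⟨fun _ _ h => ⟨h.1.symm, h.2.2.1, h.2.1, fun h' => h.2.2.2.2 ⟨h'.2, h'.1⟩,
    fun h' => h.2.2.2.1 ⟨h'.2, h'.1⟩⟩⟩
  loopless := ⟨fun _ h => h.1 rfl⟩

/-- The witness is `K_d ∨ (K_2 ∪ K_{n-d-2})` less one edge of the largest clique. -/
theorem exists_graph_of_card_eq (d : ℕ) (hd : 2 ≤ d) (hn : Fintype.card V = d ^ 2 + 5) :
    ∃ (G : SimpleGraph V) (_ : DecidableRel G.Adj), G.Connected ∧ G.minDegree = d + 1 ∧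
      (Fintype.card V : ℝ) - 3 < graphSpectralRadius G ∧ vertexConnectivity G ≤ d ∧
      ∀ a b c : ℕ, ¬ Nonempty (G ≃g joinOfCompletes a b c) := by
  classical
  have hdd : d + 2 ≤ d ^ 2 := by nlinarith
  obtain ⟨X, -, hX⟩ := Finset.exists_subset_card_eq
    (show 2 ≤ (Finset.univ : Finset V).card by rw [Finset.card_univ]; omega)
  have hXc := Finset.card_compl_add_card X
  obtain ⟨S, hSX, hS⟩ := Finset.exists_subset_card_eq (show d ≤ Xᶜ.card by omega)
  have hXS : Disjoint X S :=
    Finset.disjoint_right.2 fun a ha => Finset.mem_compl.1 (hSX ha)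
  have hY := Finset.card_compl_add_card (X ∪ S)
  rw [Finset.card_union_of_disjoint hXS] at hY
  obtain ⟨u, hu, v, hv, huv⟩ := Finset.one_lt_card.1 (show 1 < (X ∪ S)ᶜ.card by omega)
  simp only [Finset.mem_compl, Finset.mem_union, not_or] at hu hv
  obtain ⟨p, hp⟩ := Finset.card_pos.1 (show 0 < X.card by omega)
  obtain ⟨s, hs⟩ := Finset.card_pos.1 (show 0 < S.card by omega)
  have hpu : p ≠ u := fun h => hu.1 (h ▸ hp)
  have hpv : p ≠ v := fun h => hv.1 (h ▸ hp)
  have hsep : ∀ i ∈ X, ∀ j, (separatedGraph X S u v).Adj i j → j ∈ X ∨ j ∈ S :=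
    fun i hi j h => h.2.1 hi
  have : Nonempty V := ⟨p⟩
  refine ⟨separatedGraph X S u v, inferInstance, ?_, ?_, ?_, ?_, ?_⟩
  · have hsa : ∀ j, (separatedGraph X S u v).Reachable s j := by
      intro j
      by_cases hsj : s = j
      · rw [hsj]
      · refine SimpleGraph.Adj.reachable ⟨hsj, fun h => absurd hs (Finset.disjoint_left.1 hXS h),
          fun _ => Or.inr hs, fun h => hu.2 (h.1 ▸ hs), fun h => hv.2 (h.1 ▸ hs)⟩
    exact ⟨fun i j => (hsa i).symm.trans (hsa j)⟩
  · refine le_antisymm ?_ (SimpleGraph.le_minDegree_of_forall_le_degree _ _ fun i => ?_)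
    · refine ((separatedGraph X S u v).minDegree_le_degree p).trans ?_
      rw [← SimpleGraph.card_neighborFinset_eq_degree]
      have hsub : (separatedGraph X S u v).neighborFinset p ⊆ (X ∪ S).erase p := by
        intro k hk
        rw [SimpleGraph.mem_neighborFinset] at hk
        exact Finset.mem_erase.2 ⟨hk.ne', Finset.mem_union.2 (hsep p hp k hk)⟩
      refine (Finset.card_le_card hsub).trans ?_
      rw [Finset.card_erase_of_mem (Finset.mem_union_left _ hp),
        Finset.card_union_of_disjoint hXS]
      omega
    · rw [← SimpleGraph.card_neighborFinset_eq_degree]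
      by_cases hi : i ∈ X
      · have hsub : (X ∪ S).erase i ⊆ (separatedGraph X S u v).neighborFinset i := by
          intro k hk
          rw [Finset.mem_erase, Finset.mem_union] at hk
          rw [SimpleGraph.mem_neighborFinset]
          exact ⟨hk.1.symm, fun _ => hk.2, fun _ => Or.inl hi, fun h => hu.1 (h.1 ▸ hi),
            fun h => hv.1 (h.1 ▸ hi)⟩
        refine le_trans ?_ (Finset.card_le_card hsub)
        rw [Finset.card_erase_of_mem (Finset.mem_union_left _ hi),
          Finset.card_union_of_disjoint hXS]
        omega
      -- A vertex outside `X` has degree at least `n - 5 = d ^ 2`, which exceeds `d + 1` as `d ≥ 2`.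
      · have hsub : (X ∪ {i, u, v})ᶜ ⊆ (separatedGraph X S u v).neighborFinset i := by
          intro k hk
          simp only [Finset.mem_compl, Finset.mem_union, Finset.mem_insert,
            Finset.mem_singleton, not_or] at hk
          rw [SimpleGraph.mem_neighborFinset]
          exact ⟨Ne.symm hk.2.1, fun h => absurd h hi, fun h => absurd h hk.1,
            fun h => hk.2.2.2 h.2, fun h => hk.2.2.1 h.2⟩
        refine le_trans ?_ (Finset.card_le_card hsub)
        have h1 := Finset.card_compl_add_card (X ∪ {i, u, v})
        have h2 := Finset.card_union_le X {i, u, v}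
        have h3 : ({i, u, v} : Finset V).card ≤ 3 := Finset.card_le_three
        omega
  · have hd' : (2 : ℝ) ≤ d := by exact_mod_cast hd
    have hn' : (Fintype.card V : ℝ) = d ^ 2 + 5 := by exact_mod_cast hn
    refine lt_graphSpectralRadius_of_adj_iff _ hXS hu.1 hv.1 hu.2 hv.2 huv (fun _ _ => Iff.rfl)
      hX (m := (d : ℝ) ^ 2 + 3) (by linarith) (by nlinarith) ?_ (by omega) ?_
    · rw [hS]; nlinarith [sq_nonneg ((d : ℝ) ^ 2)]
    -- With `m = d ^ 2 + 3` the inequality reduces to `3 < 2 * d`.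
    · rw [hS]; nlinarith
  · rw [← hS]
    refine vertexConnectivity_le_of_isVertexCut (fun h => ?_)
      (isVertexCut_of_separation hXS hsep hp hu.1 hu.2)
    have : (separatedGraph X S u v).Adj u v := by rw [h]; exact huv
    exact this.2.2.2.1 ⟨rfl, rfl⟩
  · rintro a b c ⟨e⟩
    -- The vertices `p`, `u`, `v` are pairwise nonadjacent.
    rcases adj_of_iso_joinOfCompletes e hpu hpv huv with h | h | h
    · exact (hsep p hp u h).elim hu.1 hu.2
    · exact (hsep p hp v h).elim hv.1 hv.2
    · exact h.2.2.2.1 ⟨rfl, rfl⟩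

end Extremal

theorem theorem3p4 :
    -- the sufficient condition, with its exceptional graph
    (∀ {V : Type*} [Fintype V] [DecidableEq V] (G : SimpleGraph V) [DecidableRel G.Adj],
      G.Connected →
      2 ≤ G.minDegree →
      (G.minDegree : ℤ) ^ 2 - 2 * (G.minDegree : ℤ) + 7 ≤ (Fintype.card V : ℤ) →
      (Fintype.card V : ℝ) - 3 ≤ graphSpectralRadius G →
      (vertexConnectivity G = G.minDegree ↔
        ¬ Nonempty (G ≃g
          joinOfCompletes (G.minDegree - 1) 2 (Fintype.card V - G.minDegree - 1)))) ∧
    -- the bound on the order cannot be lowered by one, for any minimum degree at least 3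
    (∀ δ n : ℕ, 3 ≤ δ → (n : ℤ) = (δ : ℤ) ^ 2 - 2 * (δ : ℤ) + 6 →
      ∃ (G : SimpleGraph (Fin n)) (_ : DecidableRel G.Adj),
        G.Connected ∧
        G.minDegree = δ ∧
        (n : ℝ) - 3 < graphSpectralRadius G ∧
        vertexConnectivity G ≠ δ ∧
        ¬ Nonempty (G ≃g joinOfCompletes (δ - 1) 2 (n - δ - 1))) := by
  refine ⟨?_, ?_⟩
  · intro V _ _ G _ _ hδ hn hρ
    obtain ⟨e, he⟩ := Nat.exists_eq_add_of_le' (show 1 ≤ G.minDegree by omega)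
    -- `δ ^ 2 - 2 * δ + 7 = (δ - 1) ^ 2 + 6`.
    have hn' : (G.minDegree - 1) ^ 2 + 6 ≤ Fintype.card V := by
      rw [he, Nat.add_sub_cancel]
      rw [he] at hn
      zify
      push_cast at hn
      linarith
    refine ⟨?_, (vertexConnectivity_eq_minDegree_or_iso G hδ hn' hρ).resolve_right⟩
    rintro hκ ⟨f⟩
    have hc : 0 < Fintype.card V - G.minDegree - 1 := by
      rw [he, Nat.add_sub_cancel] at hn'
      have : e + 2 < Fintype.card V := by nlinarith
      omega
    have := vertexConnectivity_le_of_iso two_pos hc f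
    omega
  · intro δ n hδ hn
    obtain ⟨d, rfl⟩ := Nat.exists_eq_add_of_le' (show 1 ≤ δ by omega)
    have hn' : n = d ^ 2 + 5 := by
      zify
      push_cast at hn
      linarith
    obtain ⟨G, hdec, hconn, hmin, hρ, hκ, hiso⟩ :=
      exists_graph_of_card_eq (V := Fin n) d (by omega) (by rw [Fintype.card_fin, hn'])
    rw [Fintype.card_fin] at hρ
    exact ⟨G, hdec, hconn, hmin, hρ, by omega, hiso _ _ _⟩
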